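/- Let $C_\ell$ denote the cycle on $\ell\ge 3$ vertices. A prime labeling of a simple graph with $n$ vertices using the labels $k,k+1,\ldots,k+n-1$ (where $k$ is an integer) is a bijection from its vertex set onto $\{k,k+1,\ldots,k+n-1\}$ such that the labels of any two adjacent vertices are relatively prime. A graph with $n$ vertices is called prime if it has a prime labeling using the labels $1,2,\ldots,n$. (a) For every odd integer $n\ge 3$ and every odd integer $k$, the cycle $C_n$ has a prime labeling using the labels $k,k+1,\ldots,k+n-1$. (b) Let $G=C_{n_1}\cup\cdots\cup C_{n_m}$ be a $2$-regular graph, that is, a disjoint union of cycles with every $n_i\ge 3$. Then $G$ is prime if and only if at most one of $n_1,\ldots,n_m$ is odd. -/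

import Mathlib

/-- `f` labels the vertices of `G` bijectively with the integers `k, k + 1, …, k + n - 1`,
where `n` is the number of vertices of `G`, so that the labels of any two adjacent vertices
are relatively prime. -/
def IsPrimeLabelingFrom {V : Type*} [Fintype V] (G : SimpleGraph V) (k : ℤ) (f : V → ℤ) : Prop :=
  Set.BijOn f Set.univ (Set.Icc k (k + (Fintype.card V : ℤ) - 1)) ∧
    ∀ u v : V, G.Adj u v → Int.gcd (f u) (f v) = 1

/-- `G` is prime: it has a prime labeling with the labels `1, …, n`. -/
def IsPrimeGraph {V : Type*} [Fintype V] (G : SimpleGraph V) : Prop :=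
  ∃ f : V → ℤ, IsPrimeLabelingFrom G 1 f

/-- The disjoint union of a family of graphs. -/
def disjointUnion {ι : Type*} {V : ι → Type*} (G : ∀ i, SimpleGraph (V i)) :
    SimpleGraph (Σ i, V i) where
  Adj u v := ∃ (i : ι) (a b : V i), (G i).Adj a b ∧ u = ⟨i, a⟩ ∧ v = ⟨i, b⟩
  symm := ⟨by
    rintro u v ⟨i, a, b, h, rfl, rfl⟩
    exact ⟨i, b, a, h.symm, rfl, rfl⟩⟩
  loopless := ⟨by
    rintro u ⟨i, a, b, h, rfl, hb⟩
    obtain rfl : a = b := by simpa using hb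
    exact (G i).irrefl h⟩

/-!
The labels are grouped into segments: the segment `j` is `3 j - 1, 3 j, 3 j + 1`, with left end
`3 j - 1`, middle `3 j` and right end `3 j + 1`. Two left ends, or two right ends, of segments whose
indices differ by `1` or `3` are at distance `3` or `9` and hence coprime, and so are the right end
of a segment and the left end of the next one. Cycles are built from whole segments, each of them
traversed from one end to the other, and these edges; whatever other primes divide the labels is
then irrelevant. `CoprimePath.ladder` shows how a path grows along the segments in two parallel
strands, which leaves no gaps below and can be closed at any height.

A cycle whose length is not divisible by `6` breaks a segment, and the middle of a broken segment
must be joined to a label at distance `5`. This fails exactly when the middle is divisible by `5`;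
but then the middle of a neighbouring segment is not, and the break is moved there. In this way a
block of full segments can be filled by one cycle of length `0` modulo `6`, by two cycles of lengths
`4` and `2` modulo `6`, by three cycles of lengths `2`, and by three of lengths `4` modulo `6` (the
middle one of these breaks two segments and must not be a `4`-cycle; three `4`-cycles are
treated separately). So every family of even cycles whose total length is divisible by `6` fits on a
block (`CoprimeCycles.of_sum_dvd`), and the small labels, above all `1`, settle the remaining total
lengths (`CoprimeCycles.of_even`).

An odd cycle needs one edge between two odd labels, for which the distances `2`, `4` and `8` are
available (`CoprimeCycle.of_odd`). The only label interval that causes difficulties is one whose two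
ends are divisible by `3`; there the role of the distance `5` is taken by a prime factor of the
length minus `2`, which cannot divide both ends.

Conversely, even labels are pairwise nonadjacent, so every odd cycle carries more odd than even
labels, whereas among `1, …, N` there is at most one more odd number than even ones
(`IsPrimeGraph.eq_of_odd`).
-/

/-! ### Coprime integers at small distance -/

/-- Two integers at distance `d` are coprime if no prime factor of `d` divides the first one. -/
theorem gcd_eq_one_of_dist {x y : ℤ} (d : ℕ) (h : x - y = d ∨ y - x = d)
    (hx : ∀ p : ℕ, p.Prime → p ∣ d → ¬(p : ℤ) ∣ x) : Int.gcd x y = 1 := by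
  by_contra hne
  obtain ⟨p, hp, hpd⟩ := Nat.exists_prime_and_dvd hne
  have hpx : (p : ℤ) ∣ x := (Int.natCast_dvd_natCast.2 hpd).trans (Int.gcd_dvd_left ..)
  have hpy : (p : ℤ) ∣ y := (Int.natCast_dvd_natCast.2 hpd).trans (Int.gcd_dvd_right ..)
  refine hx p hp (Int.natCast_dvd_natCast.1 ?_) hpx
  rcases h with h | h
  · exact h ▸ dvd_sub hpx hpy
  · exact h ▸ dvd_sub hpy hpx

theorem gcd_eq_one_of_dist_prime_pow {x y : ℤ} {p : ℕ} (hp : p.Prime) (k : ℕ)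
    (h : x - y = (p ^ k : ℕ) ∨ y - x = (p ^ k : ℕ)) (hx : x % p ≠ 0) : Int.gcd x y = 1 :=
  gcd_eq_one_of_dist (p ^ k) h fun q hq hd hqx => by
    obtain rfl := (Nat.prime_dvd_prime_iff_eq hq hp).1 (hq.dvd_of_dvd_pow hd)
    exact hx (Int.emod_eq_zero_of_dvd hqx)

section Near

variable {x y : ℤ}

theorem near_one (h : x - y = 1 ∨ y - x = 1 := by omega) : Int.gcd x y = 1 :=
  gcd_eq_one_of_dist 1 h fun _ hp hd => absurd (Nat.dvd_one.1 hd) hp.ne_one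

theorem near_three (h : x - y = 3 ∨ y - x = 3 := by omega) (hx : x % 3 ≠ 0 := by omega) :
    Int.gcd x y = 1 :=
  gcd_eq_one_of_dist_prime_pow Nat.prime_three 1 h hx

theorem near_nine (h : x - y = 9 ∨ y - x = 9 := by omega) (hx : x % 3 ≠ 0 := by omega) :
    Int.gcd x y = 1 :=
  gcd_eq_one_of_dist_prime_pow Nat.prime_three 2 h hx

theorem near_five (h : x - y = 5 ∨ y - x = 5 := by omega) (hx : x % 5 ≠ 0 := by omega) :
    Int.gcd x y = 1 :=
  gcd_eq_one_of_dist_prime_pow Nat.prime_five 1 h hx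

theorem near_seven (h : x - y = 7 ∨ y - x = 7 := by omega) (hx : x % 7 ≠ 0 := by omega) :
    Int.gcd x y = 1 :=
  gcd_eq_one_of_dist_prime_pow (p := 7) (by norm_num) 1 h hx

theorem near_two (h : x - y = 2 ∨ y - x = 2 := by omega) (hx : x % 2 ≠ 0 := by omega) :
    Int.gcd x y = 1 :=
  gcd_eq_one_of_dist_prime_pow Nat.prime_two 1 h hx

theorem near_four (h : x - y = 4 ∨ y - x = 4 := by omega) (hx : x % 2 ≠ 0 := by omega) :
    Int.gcd x y = 1 :=
  gcd_eq_one_of_dist_prime_pow Nat.prime_two 2 h hx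

theorem near_eight (h : x - y = 8 ∨ y - x = 8 := by omega) (hx : x % 2 ≠ 0 := by omega) :
    Int.gcd x y = 1 :=
  gcd_eq_one_of_dist_prime_pow Nat.prime_two 3 h hx

theorem near_fifteen (h : x - y = 15 ∨ y - x = 15 := by omega) (hx : x % 3 ≠ 0 := by omega)
    (hx' : x % 5 ≠ 0 := by omega) : Int.gcd x y = 1 :=
  gcd_eq_one_of_dist 15 h fun p hp hd hpx => by
    rcases hp.dvd_mul.1 (show p ∣ 3 * 5 from hd) with h | h
    · obtain rfl := (Nat.prime_dvd_prime_iff_eq hp Nat.prime_three).1 h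
      exact hx (Int.emod_eq_zero_of_dvd hpx)
    · obtain rfl := (Nat.prime_dvd_prime_iff_eq hp Nat.prime_five).1 h
      exact hx' (Int.emod_eq_zero_of_dvd hpx)

end Near

/-! ### Coprime paths and coprime cycles -/

/-- There is a list of `n` integers, beginning with `u` and ending with `v`, in which neighbours
are coprime and in which every element of `C` occurs. The list is not required to be free of
repetitions: the number of its entries is compared with the number of labels to be covered only
once all cycles have been written down. -/
def CoprimePath (u v : ℤ) (n : ℕ) (C : Set ℤ) : Prop :=
  ∃ l : List ℤ, l.IsChain (fun x y => Int.gcd x y = 1) ∧ l.head? = some u ∧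
    l.getLast? = some v ∧ l.length = n ∧ ∀ x ∈ C, x ∈ l

/-- A list of integers is a coprime cycle if its neighbours are coprime, the last and the first
entry being neighbours too. -/
def IsCoprimeCycle (l : List ℤ) : Prop :=
  l.IsChain (fun x y => Int.gcd x y = 1) ∧
    ∀ x ∈ l.getLast?, ∀ y ∈ l.head?, Int.gcd x y = 1

/-- There is a coprime cycle of length `n` in which every element of `C` occurs. -/
def CoprimeCycle (n : ℕ) (C : Set ℤ) : Prop :=
  ∃ l : List ℤ, IsCoprimeCycle l ∧ l.length = n ∧ ∀ x ∈ C, x ∈ l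

namespace CoprimePath

variable {u v u' v' : ℤ} {n n' : ℕ} {C C' : Set ℤ}

theorem single (x : ℤ) : CoprimePath x x 1 {x} :=
  ⟨[x], by simp, rfl, rfl, rfl, by simp⟩

theorem symm (h : CoprimePath u v n C) : CoprimePath v u n C := by
  obtain ⟨l, hl, hu, hv, hn, hC⟩ := h
  refine ⟨l.reverse, ?_, by simpa using hv, by simpa using hu, by simpa using hn,
    by simpa using hC⟩
  rw [List.isChain_reverse]
  exact hl.imp fun a b hab => by rwa [Int.gcd_comm]

theorem join (h : CoprimePath u v n C) (h' : CoprimePath u' v' n' C')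
    (hvu : Int.gcd v u' = 1) : CoprimePath u v' (n + n') (C ∪ C') := by
  obtain ⟨l, hl, hu, hv, hn, hC⟩ := h
  obtain ⟨l', hl', hu', hv', hn', hC'⟩ := h'
  refine ⟨l ++ l', ?_, by simp [List.head?_append, hu], by simp [List.getLast?_append, hv'],
    by simp [hn, hn'], ?_⟩
  · rw [List.isChain_append]
    refine ⟨hl, hl', fun x hx y hy => ?_⟩
    rw [hv] at hx; rw [hu'] at hy
    simp only [Option.mem_def, Option.some.injEq] at hx hy
    rwa [← hx, ← hy]
  · rintro x (hx | hx)
    · exact List.mem_append_left _ (hC x hx)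
    · exact List.mem_append_right _ (hC' x hx)

theorem congr (h : CoprimePath u v n C) (hu : u = u') (hv : v = v') (hn : n = n')
    (hC : ∀ x ∈ C', x ∈ C) : CoprimePath u' v' n' C' := by
  subst hu hv hn
  obtain ⟨l, hl, hu, hv, hn, h⟩ := h
  exact ⟨l, hl, hu, hv, hn, fun x hx => h x (hC x hx)⟩

theorem close (h : CoprimePath u v n C) (hvu : Int.gcd v u = 1) (hn : n = n')
    (hC : ∀ x ∈ C', x ∈ C) : CoprimeCycle n' C' := by
  obtain ⟨l, hl, hu, hv, hn', hC'⟩ := h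
  refine ⟨l, ⟨hl, fun x hx y hy => ?_⟩, hn'.trans hn, fun x hx => hC' x (hC x hx)⟩
  rw [hv] at hx; rw [hu] at hy
  simp only [Option.mem_def, Option.some.injEq] at hx hy
  rwa [← hx, ← hy]

/-- Consecutive integers form a coprime path. -/
theorem run (a : ℤ) (n : ℕ) : CoprimePath a (a + n) (n + 1) (Set.Icc a (a + n)) := by
  induction n with
  | zero => exact (single a).congr rfl (by simp) rfl (by simp)
  | succ n ih =>
    refine (ih.join (single (a + n + 1)) near_one).congr rfl
      (by push_cast; ring) rfl ?_
    intro x hx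
    simp only [Set.mem_union, Set.mem_Icc, Set.mem_singleton_iff] at *
    omega

theorem run' {a b : ℤ} {n : ℕ} (h : b = a + n) : CoprimePath a b (n + 1) (Set.Icc a b) := by
  subst h; exact run a n

/-- The segment `3 j - 1, 3 j, 3 j + 1`. -/
theorem seg (j : ℤ) : CoprimePath (3 * j - 1) (3 * j + 1) 3 (Set.Icc (3 * j - 1) (3 * j + 1)) :=
  run' (n := 2) (by push_cast; ring)

end CoprimePath

theorem CoprimeCycle.mono {n n' : ℕ} {C C' : Set ℤ} (h : CoprimeCycle n C) (hn : n = n')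
    (hC : ∀ x ∈ C', x ∈ C) : CoprimeCycle n' C' := by
  obtain ⟨l, hl, hn', h⟩ := h
  exact ⟨l, hl, hn'.trans hn, fun x hx => h x (hC x hx)⟩

theorem IsCoprimeCycle.map {l : List ℤ} (h : IsCoprimeCycle l) {f : ℤ → ℤ}
    (hf : ∀ x y, Int.gcd x y = 1 → Int.gcd (f x) (f y) = 1) : IsCoprimeCycle (l.map f) := by
  refine ⟨?_, ?_⟩
  · rw [List.isChain_map]
    exact h.1.imp fun a b => hf a b
  · intro x hx y hy
    simp only [List.getLast?_map, List.head?_map, Option.mem_def, Option.map_eq_some_iff]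
      at hx hy
    obtain ⟨x, hx, rfl⟩ := hx
    obtain ⟨y, hy, rfl⟩ := hy
    exact hf x y (h.2 x hx y hy)

/-- Coprime cycles may be reflected at `0`; this exchanges the two ends of a label interval. -/
theorem CoprimeCycle.neg {n : ℕ} {C C' : Set ℤ} (h : CoprimeCycle n C)
    (hC : ∀ x ∈ C', -x ∈ C) : CoprimeCycle n C' := by
  obtain ⟨l, hl, hn, h⟩ := h
  exact ⟨l.map (-·), hl.map (by simp), by simpa using hn,
    fun x hx => List.mem_map.2 ⟨-x, h _ (hC x hx), by simp⟩⟩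

/-! ### Ladders -/

namespace CoprimePath

variable {n : ℕ} {C : Set ℤ} {t : ℤ}

/-- A path ending in the left end of the segment `t - 1` and the right end of the segment `t`
absorbs the next two segments, and its ends are again of this kind; so it absorbs `2 m` segments. -/
theorem ladder (h : CoprimePath (3 * t - 4) (3 * t + 1) n C) (m : ℕ) :
    CoprimePath (3 * (t + 2 * m) - 4) (3 * (t + 2 * m) + 1) (n + 6 * m)
      (C ∪ Set.Ioc (3 * t + 1) (3 * (t + 2 * m) + 1)) := by
  induction m with
  | zero => exact h.congr (by simp) (by simp) rfl (by intro x; simp)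
  | succ m ih =>
    refine (((seg (t + 2 * m + 2)).symm.join ih near_nine).join
      (seg (t + 2 * m + 1)).symm near_three).symm.congr (by omega) (by omega) (by omega) ?_
    intro x
    by_cases hC : x ∈ C <;> simp [hC]
    omega

/-- A path ending in the right ends of the segments `t - 1` and `t` absorbs any positive even
number of the following segments in such a way that it then ends in the left end of the last
segment but one. -/
theorem exists_of_right_ends (h : CoprimePath (3 * t - 2) (3 * t + 1) n C) {m : ℕ}
    (hm : 1 ≤ m) :
    ∃ v, (v = 3 * (t + 2 * m) - 1 ∨ v = 3 * (t + 2 * m) + 1) ∧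
      CoprimePath (3 * (t + 2 * m) - 4) v (n + 6 * m)
        (C ∪ Set.Ioc (3 * t + 1) (3 * (t + 2 * m) + 1)) := by
  obtain rfl | ⟨m, rfl⟩ : m = 1 ∨ ∃ m', m = m' + 2 := by
    rcases m with _ | _ | m
    · omega
    · exact Or.inl rfl
    · exact Or.inr ⟨m, rfl⟩
  · refine ⟨_, Or.inl rfl, (((seg (t + 2)).join h near_nine).join (seg (t + 1)).symm
      near_three).symm.congr (by omega) (by omega) (by omega) ?_⟩
    intro x
    by_cases hC : x ∈ C <;> simp [hC]
    omega
  · -- One strand runs through the segments `t + 2`, `t + 1`, `t + 4`, the other through `t + 3`.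
    have h4 : CoprimePath (3 * (t + 4) - 4) (3 * (t + 4) + 1) (n + 12)
        (C ∪ Set.Ioc (3 * t + 1) (3 * (t + 4) + 1)) := by
      refine (((((seg (t + 4)).symm.join (seg (t + 1)) near_nine).join (seg (t + 2))
        near_one).join h near_nine).join (seg (t + 3)).symm near_nine).symm.congr
        (by omega) (by omega) (by omega) ?_
      intro x
      by_cases hC : x ∈ C <;> simp [hC]
      omega
    refine ⟨_, Or.inr rfl, (h4.ladder m).congr (by omega) (by omega) (by omega) ?_⟩
    intro x
    by_cases hC : x ∈ C <;> simp [hC]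
    omega

end CoprimePath

/-! ### Even cycles on label sets that start with full segments -/

namespace CoprimeCycle

open CoprimePath

/-- Two consecutive integers in decreasing order. -/
theorem _root_.CoprimePath.pair (a : ℤ) : CoprimePath (a + 1) a 2 (Set.Icc a (a + 1)) :=
  (run' (n := 1) rfl).symm

/-- The first two segments of a block, with ends fit for `CoprimePath.ladder`. -/
theorem _root_.CoprimePath.twoSeg (b : ℤ) :
    CoprimePath (3 * (b + 1) - 4) (3 * (b + 1) + 1) 6 (Set.Icc (3 * b - 1) (3 * b + 4)) :=
  ((seg b).join (seg (b + 1)) near_one).congr (by omega) rfl rfl (by intro x; simp; omega)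

/-- The full segments from `b` to `b + 2 q - 1`. -/
theorem full (b : ℤ) {q : ℕ} (hq : 1 ≤ q) :
    CoprimeCycle (6 * q) (Set.Icc (3 * b - 1) (3 * b - 2 + 6 * q)) := by
  obtain rfl | ⟨m, rfl⟩ : q = 1 ∨ ∃ m, q = m + 2 := by
    rcases q with _ | _ | m
    · omega
    · exact Or.inl rfl
    · exact Or.inr ⟨m, rfl⟩
  · exact ((seg b).join (seg (b + 1)).symm near_three).close near_three rfl
      (by intro x; simp; omega)
  · exact (((twoSeg b).ladder m).join ((seg (b + 2 * m + 2)).join (seg (b + 2 * m + 3)).symm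
      near_three) near_one).close near_nine (by omega) (by intro x; simp; omega)

/-- The full segments from `b` to `b + 2 a`, and the left end of the next segment. -/
theorem upToLeft (b : ℤ) (a : ℕ) :
    CoprimeCycle (6 * a + 4) (Set.Icc (3 * b - 1) (3 * b + 6 * a + 2)) := by
  rcases a with _ | m
  · exact ((seg b).join (single (3 * b + 2)) near_one).close near_three rfl
      (by intro x; simp; omega)
  · exact ((((twoSeg b).ladder m).join (seg (b + 2 * m + 2)) near_one).join
      (single (3 * (b + 2 * m + 3) - 1)) near_one).close near_nine (by omega)
      (by intro x; simp; omega)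

/-- The segments from `b` to `b + 2 a - 1`, the right end of the segment `b + 2 a`, and the segment
`b + 2 a + 1`. This leaves the middle of the segment `b + 2 a` for another cycle and is used when
the middle of the segment `b + 2 a + 1` is divisible by `5`. -/
theorem upToLeft_shifted (b : ℤ) (a : ℕ) :
    CoprimeCycle (6 * a + 4) (Set.Icc (3 * b - 1) (3 * (b + 2 * a) - 2) ∪
      Set.Icc (3 * (b + 2 * a) + 1) (3 * (b + 2 * a) + 4)) := by
  rcases a with _ | m
  · exact ((single (3 * b + 1)).join (seg (b + 1)) near_one).close near_three rfl
      (by intro x; simp; omega)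
  · exact ((((twoSeg b).ladder m).join (single (3 * (b + 2 * m + 2) + 1)) near_three).join
      (seg (b + 2 * m + 3)).symm near_three).close near_nine (by omega)
      (by intro x; simp; omega)

/-- The full segments from `b` to `b + 2 q - 1`, and the left end and the middle of the segment
`b + 2 q`. This middle is joined to a label at distance `5`; when it is divisible by `5`, the
segment to be broken is the next one, as in `upToMiddle_shifted`. -/
theorem upToMiddle (b : ℤ) {q : ℕ} (hq : 1 ≤ q) (h5 : 3 * (b + 2 * q) % 5 ≠ 0) :
    CoprimeCycle (6 * q + 2) (Set.Icc (3 * b - 1) (3 * (b + 2 * q))) := by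
  obtain rfl | ⟨m, rfl⟩ : q = 1 ∨ ∃ m, q = m + 2 := by
    rcases q with _ | _ | m
    · omega
    · exact Or.inl rfl
    · exact Or.inr ⟨m, rfl⟩
  · exact (((seg b).symm.join (seg (b + 1)) near_three).join (pair (3 * b + 5)).symm
      near_one).close near_five rfl (by intro x; simp; omega)
  · exact (((((twoSeg b).ladder m).join (seg (b + 2 * m + 2)) near_one).join
      (pair (3 * (b + 2 * m + 4) - 1)) near_five).join (seg (b + 2 * m + 3)).symm
      near_one).close near_nine (by omega) (by intro x; simp; omega)

/-- The full segments from `b` to `b + 2 q - 1`, and the middle and the right end of the segment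
`b + 2 q + 1`. -/
theorem upToMiddle_shifted (b : ℤ) {q : ℕ} (hq : 1 ≤ q) (h5 : 3 * (b + 2 * q + 1) % 5 ≠ 0) :
    CoprimeCycle (6 * q + 2) (Set.Icc (3 * b - 1) (3 * (b + 2 * q) - 2) ∪
      Set.Icc (3 * (b + 2 * q + 1)) (3 * (b + 2 * q + 1) + 1)) := by
  obtain rfl | ⟨m, rfl⟩ : q = 1 ∨ ∃ m, q = m + 2 := by
    rcases q with _ | _ | m
    · omega
    · exact Or.inl rfl
    · exact Or.inr ⟨m, rfl⟩
  · exact (((seg b).join (pair (3 * (b + 3))) near_nine).join (seg (b + 1)).symm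
      near_five).close near_three rfl (by intro x; simp; omega)
  · exact (((((twoSeg b).ladder m).join (seg (b + 2 * m + 2)) near_one).join
      (pair (3 * (b + 2 * m + 5))) near_nine).join (seg (b + 2 * m + 3)).symm
      near_five).close near_nine (by omega) (by intro x; simp; omega)

/-! ### Even cycles on label sets that end with full segments -/

theorem fromRight (p : ℤ) (a : ℕ) :
    CoprimeCycle (6 * a + 4) (Set.Icc (3 * p + 1) (3 * p + 6 * a + 4)) :=
  (upToLeft (-p - 2 * a - 1) a).neg (by intro x; simp; omega)

theorem fromRight_shifted (p : ℤ) (a : ℕ) :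
    CoprimeCycle (6 * a + 4) (Set.Icc (3 * p - 1) (3 * p + 2) ∪
      Set.Icc (3 * p + 5) (3 * p + 6 * a + 4)) :=
  (upToLeft_shifted (-p - 1 - 2 * a) a).neg (by intro x; simp; omega)

theorem fromMiddle (j : ℤ) {q : ℕ} (hq : 1 ≤ q) (h5 : 3 * j % 5 ≠ 0) :
    CoprimeCycle (6 * q + 2) (Set.Icc (3 * j) (3 * j + 6 * q + 1)) :=
  (upToMiddle (-j - 2 * q) hq (by omega)).neg (by intro x; simp; omega)

/-- The left end and the middle of the segment `j - 1`, and the segments from `j + 1` on. -/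
theorem fromMiddle_shifted (j : ℤ) {q : ℕ} (hq : 1 ≤ q) (h5 : 3 * j % 5 = 0) :
    CoprimeCycle (6 * q + 2) (Set.Icc (3 * j - 4) (3 * j - 3) ∪
      Set.Icc (3 * j + 2) (3 * j + 6 * q + 1)) :=
  (upToMiddle_shifted (-j - 2 * q) hq (by omega)).neg (by intro x; simp; omega)

/-! ### Even cycles between two broken segments -/

/-- The right end of the segment `p`, full segments, and the left end of the segment
`p + 2 q + 1`. -/
theorem rightToLeft (p : ℤ) {q : ℕ} (hq : 1 ≤ q) :
    CoprimeCycle (6 * q + 2) (Set.Icc (3 * p + 1) (3 * p + 6 * q + 2)) := by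
  obtain rfl | ⟨m, hm, rfl⟩ : q = 1 ∨ ∃ m, 1 ≤ m ∧ q = m + 1 := by
    rcases q with _ | _ | m
    · omega
    · exact Or.inl rfl
    · exact Or.inr ⟨m + 1, by omega, rfl⟩
  · -- A middle has to be joined to a label at distance `5`. Of the labels `3 p + 1` and `3 p + 3`
    -- at most one is divisible by `5`.
    by_cases h5 : (3 * p + 1) % 5 = 0
    · exact ((((run' (a := 3 * p + 1) (b := 3 * p + 3) (n := 2) (by omega)).join
        (single (3 * p + 8)) near_five).join (run' (a := 3 * p + 5) (b := 3 * p + 7) (n := 2)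
        (by omega)) near_three).join (single (3 * p + 4)) near_three).close near_three rfl
        (by intro x; simp; omega)
    · exact (((single (3 * p + 1)).join (pair (3 * p + 5)) near_five).join
        (((single (3 * p + 8)).join (single (3 * p + 7)) near_one).join
        (seg (p + 1)).symm near_three) near_three).close near_one rfl
        (by intro x; simp; omega)
  · obtain ⟨v, hv, h⟩ := ((((single (3 * p + 1)).join (seg (p + 1)) near_one).congr
      (u' := 3 * (p + 1) - 2) (by omega) rfl rfl fun _ h => h).exists_of_right_ends hm)
    have hv' : Int.gcd v (3 * (p + 2 * m + 2) - 1) = 1 := by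
      rcases hv with rfl | rfl
      · exact near_three
      · exact near_one
    exact ((h.join (seg (p + 2 * m + 2)) hv').join (single (3 * p + 6 * m + 8))
      near_one).close near_nine (by omega) (by intro x; simp; omega)

/-- A beginning, fit for `CoprimePath.ladder`, that covers the segment `p`, the left end of the
segment `p + 1`, and the segments `p + 2` and `p + 3`. -/
theorem _root_.CoprimePath.shiftedRight (p : ℤ) (h5 : 3 * p % 5 = 0) :
    CoprimePath (3 * (p + 3) - 4) (3 * (p + 3) + 1) 10
      (Set.Icc (3 * p - 1) (3 * p + 2) ∪ Set.Icc (3 * p + 5) (3 * p + 10)) :=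
  ((((seg (p + 2)).join (single (3 * p + 2)) near_five).join (seg p).symm near_one).join
    (seg (p + 3)) near_nine).congr (by omega) rfl rfl (by intro x; simp; omega)

/-- The segment `p`, the left end of the segment `p + 1`, the segments from `p + 2` to `p + 2 q`,
and the left end of the next segment. -/
theorem rightToLeft_shiftedRight (p : ℤ) {q : ℕ} (hq : 1 ≤ q) (h5 : 3 * p % 5 = 0) :
    CoprimeCycle (6 * q + 2) (Set.Icc (3 * p - 1) (3 * p + 2) ∪
      Set.Icc (3 * p + 5) (3 * p + 6 * q + 2)) := by
  obtain rfl | ⟨m, rfl⟩ : q = 1 ∨ ∃ m, q = m + 2 := by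
    rcases q with _ | _ | m
    · omega
    · exact Or.inl rfl
    · exact Or.inr ⟨m, rfl⟩
  · exact ((run' (a := 3 * p - 1) (b := 3 * p + 2) (n := 3) (by omega)).join
      (run' (a := 3 * p + 5) (b := 3 * p + 8) (n := 3) (by omega)) near_three).close near_nine
      rfl (by intro x; simp; omega)
  · exact ((((shiftedRight p h5).ladder m).join (seg (p + 2 * m + 4)) near_one).join
      (single (3 * p + 6 * m + 14)) near_one).close near_nine (by omega)
      (by intro x; simp; omega)

/-- The reflection of `rightToLeft_shiftedRight`. -/
theorem rightToLeft_shiftedLeft (p : ℤ) {q : ℕ} (hq : 1 ≤ q)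
    (h5 : 3 * (p + 2 * q + 1) % 5 = 0) :
    CoprimeCycle (6 * q + 2) (Set.Icc (3 * p + 1) (3 * p + 6 * q - 2) ∪
      Set.Icc (3 * p + 6 * q + 1) (3 * p + 6 * q + 4)) :=
  (rightToLeft_shiftedRight (-p - 2 * q - 1) hq (by omega)).neg (by intro x; simp; omega)

/-- The label set is that of `rightToLeft_shiftedRight` below and that of `rightToLeft_shiftedLeft`
above. The hypotheses exclude `q = 1`. -/
theorem rightToLeft_shiftedBoth (p : ℤ) {q : ℕ} (hq : 1 ≤ q) (h5 : 3 * p % 5 = 0)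
    (h5' : 3 * (p + 2 * q + 1) % 5 = 0) :
    CoprimeCycle (6 * q + 2) (Set.Icc (3 * p - 1) (3 * p + 2) ∪
      Set.Icc (3 * p + 5) (3 * p + 6 * q - 2) ∪
      Set.Icc (3 * p + 6 * q + 1) (3 * p + 6 * q + 4)) := by
  obtain ⟨m, rfl⟩ : ∃ m, q = m + 2 := ⟨q - 2, by omega⟩
  exact ((((shiftedRight p h5).ladder m).join (single (3 * (p + 2 * m + 4) + 1)) near_three).join
    (seg (p + 2 * m + 5)).symm near_three).close near_nine (by omega) (by intro x; simp; omega)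

/-- A beginning, fit for `CoprimePath.ladder`, that covers the middle and the right end of the
segment `j` and the next two segments. -/
theorem _root_.CoprimePath.middle (j : ℤ) (h5 : 3 * j % 5 ≠ 0) :
    CoprimePath (3 * (j + 2) - 4) (3 * (j + 2) + 1) 8 (Set.Icc (3 * j) (3 * j + 7)) :=
  (((seg (j + 1)).join (pair (3 * j)) near_three).join (seg (j + 2)) near_five).congr
    (by omega) rfl rfl (by intro x; simp; omega)

/-- The middle and the right end of the segment `j`, full segments, and the left end and the middle
of the segment `j + 2 a + 1`. -/
theorem middleToMiddle (j : ℤ) {a : ℕ} (ha : 1 ≤ a) (h5 : 3 * j % 5 ≠ 0)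
    (h5' : 3 * (j + 2 * a + 1) % 5 ≠ 0) :
    CoprimeCycle (6 * a + 4) (Set.Icc (3 * j) (3 * j + 6 * a + 3)) := by
  obtain rfl | ⟨m, rfl⟩ : a = 1 ∨ ∃ m, a = m + 2 := by
    rcases a with _ | _ | m
    · omega
    · exact Or.inl rfl
    · exact Or.inr ⟨m, rfl⟩
  · exact (((((single (3 * j)).join (seg (j + 2)) near_five).join (pair (3 * j + 8)).symm
      near_one).join (seg (j + 1)).symm near_five).join (single (3 * j + 1)) near_one).close
      near_one rfl (by intro x; simp; omega)
  · exact (((((middle j h5).ladder m).join (seg (j + 2 * m + 3)) near_one).join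
      (pair (3 * (j + 2 * m + 5) - 1)) near_five).join (seg (j + 2 * m + 4)).symm
      near_one).close near_nine (by omega) (by intro x; simp; omega)

/-- The label set of `middleToMiddle` with the end moved to the middle and the right end of the
segment `j + 2 a + 2`; the segment `j + 2 a + 1` is left out. -/
theorem middleToMiddle_shiftedLeft (j : ℤ) {a : ℕ} (ha : 1 ≤ a) (h5 : 3 * j % 5 ≠ 0)
    (h5' : 3 * (j + 2 * a + 1) % 5 = 0) :
    CoprimeCycle (6 * a + 4) (Set.Icc (3 * j) (3 * j + 6 * a + 1) ∪
      Set.Icc (3 * j + 6 * a + 6) (3 * j + 6 * a + 7)) := by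
  obtain rfl | ⟨m, rfl⟩ : a = 1 ∨ ∃ m, a = m + 2 := by
    rcases a with _ | _ | m
    · omega
    · exact Or.inl rfl
    · exact Or.inr ⟨m, rfl⟩
  · exact (((((single (3 * j)).join (seg (j + 2)) near_five).join (pair (3 * j + 12)).symm
      near_five).join (seg (j + 1)).symm near_nine).join (single (3 * j + 1)) near_one).close
      near_one rfl (by intro x; simp; omega)
  · exact (((((middle j h5).ladder m).join (seg (j + 2 * m + 3)) near_one).join
      (pair (3 * (j + 2 * m + 6))) near_nine).join (seg (j + 2 * m + 4)).symm
      near_five).close near_nine (by omega) (by intro x; simp; omega)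

/-- The reflection of `middleToMiddle_shiftedLeft`. -/
theorem middleToMiddle_shiftedRight (j : ℤ) {a : ℕ} (ha : 1 ≤ a) (h5 : 3 * j % 5 = 0)
    (h5' : 3 * (j + 2 * a + 1) % 5 ≠ 0) :
    CoprimeCycle (6 * a + 4) (Set.Icc (3 * j - 4) (3 * j - 3) ∪
      Set.Icc (3 * j + 2) (3 * j + 6 * a + 3)) :=
  (middleToMiddle_shiftedLeft (-j - 2 * a - 1) ha (by omega) (by omega)).neg
    (by intro x; simp; omega)

/-- The label set is that of `middleToMiddle_shiftedRight` below and that of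
`middleToMiddle_shiftedLeft` above. -/
theorem middleToMiddle_shiftedBoth (j : ℤ) {a : ℕ} (ha : 1 ≤ a) (h5 : 3 * j % 5 = 0)
    (h5' : 3 * (j + 2 * a + 1) % 5 = 0) :
    CoprimeCycle (6 * a + 4) (Set.Icc (3 * j - 4) (3 * j - 3) ∪
      Set.Icc (3 * j + 2) (3 * j + 6 * a + 1) ∪
      Set.Icc (3 * j + 6 * a + 6) (3 * j + 6 * a + 7)) := by
  -- Both hypotheses together make `2 a + 1` divisible by `5`.
  obtain rfl | ⟨m, hm, rfl⟩ : a = 2 ∨ ∃ m, 1 ≤ m ∧ a = m + 2 := by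
    rcases a with _ | _ | _ | m
    · omega
    · omega
    · exact Or.inl rfl
    · exact Or.inr ⟨m + 1, by omega, rfl⟩
  · exact ((((pair (3 * j - 4)).symm.join (run' (a := 3 * j + 2) (b := 3 * j + 10) (n := 8)
      (by omega)) near_five).join (pair (3 * j + 18)) near_nine).join
      (run' (a := 3 * j + 11) (b := 3 * j + 13) (n := 2) (by omega)).symm near_five).close
      near_fifteen rfl (by intro x; simp; omega)
  · obtain ⟨v, hv, h⟩ := ((((seg (j + 1)).symm.join (pair (3 * j - 4)) near_five).join
      (seg (j + 2)) near_nine).congr (u' := 3 * (j + 2) - 2) (by omega) rfl rfl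
      fun _ h => h).exists_of_right_ends hm
    have hv' : Int.gcd v (3 * (j + 2 * m + 3) - 1) = 1 := by
      rcases hv with rfl | rfl
      · exact near_three
      · exact near_one
    exact (((h.join (seg (j + 2 * m + 3)) hv').join (pair (3 * (j + 2 * m + 6))) near_nine).join
      (seg (j + 2 * m + 4)).symm near_five).close near_nine (by omega) (by intro x; simp; omega)

end CoprimeCycle

/-! ### Families of even cycles on a block of full segments -/

/-- There are coprime cycles, with the lengths listed in `s`, that together cover `C`. -/
def CoprimeCycles (s : Multiset ℕ) (C : Set ℤ) : Prop :=
  ∃ F : Multiset (List ℤ), F.map List.length = s ∧ (∀ l ∈ F, IsCoprimeCycle l) ∧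
    ∀ x ∈ C, ∃ l ∈ F, x ∈ l

theorem CoprimeCycle.cycles {n : ℕ} {C : Set ℤ} (h : CoprimeCycle n C) :
    CoprimeCycles {n} C := by
  obtain ⟨l, hl, hn, hC⟩ := h
  exact ⟨{l}, by simp [hn], by simpa using hl, by simpa using hC⟩

namespace CoprimeCycles

variable {s s' : Multiset ℕ} {C C' : Set ℤ}

theorem mono (h : CoprimeCycles s C) (hs : s = s') (hC : ∀ x ∈ C', x ∈ C) :
    CoprimeCycles s' C' := by
  obtain ⟨F, hF, hc, h⟩ := h
  exact ⟨F, hF.trans hs, hc, fun x hx => h x (hC x hx)⟩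

theorem add (h : CoprimeCycles s C) (h' : CoprimeCycles s' C') :
    CoprimeCycles (s + s') (C ∪ C') := by
  obtain ⟨F, hF, hc, h⟩ := h
  obtain ⟨F', hF', hc', h'⟩ := h'
  refine ⟨F + F', by simp [hF, hF'], fun l hl => ?_, ?_⟩
  · exact (Multiset.mem_add.1 hl).elim (hc l) (hc' l)
  · rintro x (hx | hx)
    · obtain ⟨l, hl, hxl⟩ := h x hx
      exact ⟨l, Multiset.mem_add.2 (Or.inl hl), hxl⟩
    · obtain ⟨l, hl, hxl⟩ := h' x hx
      exact ⟨l, Multiset.mem_add.2 (Or.inr hl), hxl⟩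

open CoprimeCycle CoprimePath

theorem four_two (b : ℤ) (x : ℕ) {y : ℕ} (hy : 1 ≤ y) :
    CoprimeCycles ({6 * x + 4} + {6 * y + 2})
      (Set.Icc (3 * b - 1) (3 * b + 6 * x + 6 * y + 4)) := by
  by_cases h5 : 3 * (b + 2 * x + 1) % 5 = 0
  · exact ((upToLeft_shifted b x).cycles.add (fromMiddle_shifted (b + 2 * x + 1) hy
      h5).cycles).mono rfl (by intro z; simp; omega)
  · exact ((upToLeft b x).cycles.add (fromMiddle (b + 2 * x + 1) hy h5).cycles).mono rfl
      (by intro z; simp; omega)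

theorem two_two_two (b : ℤ) {x y z : ℕ} (hx : 1 ≤ x) (hy : 1 ≤ y) (hz : 1 ≤ z) :
    CoprimeCycles ({6 * x + 2} + {6 * y + 2} + {6 * z + 2})
      (Set.Icc (3 * b - 1) (3 * b + 6 * x + 6 * y + 6 * z + 4)) := by
  have r : b + 2 * (x + y : ℕ) + 1 = b + 2 * x + 2 * y + 1 := by push_cast; ring
  by_cases h5 : 3 * (b + 2 * x) % 5 = 0 <;> by_cases h5' : 3 * (b + 2 * x + 2 * y + 1) % 5 = 0
  · exact (((upToMiddle_shifted b hx (by omega)).cycles.add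
      (rightToLeft_shiftedBoth (b + 2 * x) hy h5 h5').cycles).add
      (fromMiddle_shifted (b + 2 * x + 2 * y + 1) hz h5').cycles).mono rfl
      (by intro w; simp; omega)
  · exact (((upToMiddle_shifted b hx (by omega)).cycles.add
      (rightToLeft_shiftedRight (b + 2 * x) hy h5).cycles).add
      (fromMiddle (b + 2 * x + 2 * y + 1) hz h5').cycles).mono rfl (by intro w; simp; omega)
  · exact (((upToMiddle b hx h5).cycles.add
      (rightToLeft_shiftedLeft (b + 2 * x) hy h5').cycles).add
      (fromMiddle_shifted (b + 2 * x + 2 * y + 1) hz h5').cycles).mono rfl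
      (by intro w; simp; omega)
  · exact (((upToMiddle b hx h5).cycles.add (rightToLeft (b + 2 * x) hy).cycles).add
      (fromMiddle (b + 2 * x + 2 * y + 1) hz h5').cycles).mono rfl (by intro w; simp; omega)

/-- Three cycles of lengths `4` modulo `6`. The middle one meets both broken segments, so it must
not be a `4`-cycle. -/
theorem four_four_four (b : ℤ) (x z : ℕ) {y : ℕ} (hy : 1 ≤ y) :
    CoprimeCycles ({6 * x + 4} + {6 * y + 4} + {6 * z + 4})
      (Set.Icc (3 * b - 1) (3 * b + 6 * x + 6 * y + 6 * z + 10)) := by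
  by_cases h5 : 3 * (b + 2 * x + 1) % 5 = 0 <;>
    by_cases h5' : 3 * (b + 2 * x + 1 + 2 * y + 1) % 5 = 0
  · exact (((upToLeft_shifted b x).cycles.add
      (middleToMiddle_shiftedBoth (b + 2 * x + 1) hy h5 h5').cycles).add
      (fromRight_shifted (b + 2 * x + 1 + 2 * y + 1) z).cycles).mono rfl
      (by intro w; simp; omega)
  · exact (((upToLeft_shifted b x).cycles.add
      (middleToMiddle_shiftedRight (b + 2 * x + 1) hy h5 h5').cycles).add
      (fromRight (b + 2 * x + 1 + 2 * y + 1) z).cycles).mono rfl (by intro w; simp; omega)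
  · exact (((upToLeft b x).cycles.add
      (middleToMiddle_shiftedLeft (b + 2 * x + 1) hy h5 h5').cycles).add
      (fromRight_shifted (b + 2 * x + 1 + 2 * y + 1) z).cycles).mono rfl
      (by intro w; simp; omega)
  · exact (((upToLeft b x).cycles.add
      (middleToMiddle (b + 2 * x + 1) hy h5 h5').cycles).add
      (fromRight (b + 2 * x + 1 + 2 * y + 1) z).cycles).mono rfl (by intro w; simp; omega)

theorem _root_.CoprimeCycle.ofFour {a b c d : ℤ} (hab : Int.gcd a b = 1) (hbc : Int.gcd b c = 1)
    (hcd : Int.gcd c d = 1) (hda : Int.gcd d a = 1) : CoprimeCycle 4 {a, b, c, d} :=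
  ⟨[a, b, c, d], ⟨by simp [hab, hbc, hcd], by simpa using hda⟩, rfl, by simp⟩

/-- Three `4`-cycles on twelve labels. Two of the four multiples of `3` lie on a common `4`-cycle,
which then has edges between labels at distance `5` and `7`. -/
theorem three_squares (b : ℤ) :
    CoprimeCycles ({4} + {4} + {4}) (Set.Icc (3 * b - 1) (3 * b + 10)) := by
  by_cases h7 : (3 * b + 3) % 7 = 0
  · have h : CoprimeCycle 4 (Set.Icc (3 * b + 7) (3 * b + 10)) :=
      (fromRight (b + 2) 0).mono rfl (by intro x; simp; omega)
    by_cases h5 : (3 * b + 6) % 5 = 0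
    · refine ((h.cycles.add (ofFour (a := 3 * b + 4) (b := 3 * b + 3) (c := 3 * b + 2)
        (d := 3 * b + 1) near_one near_one near_one near_three).cycles).add
        (ofFour (a := 3 * b + 6) (b := 3 * b + 5) (c := 3 * b) (d := 3 * b - 1) near_one
          near_five near_one near_seven).cycles).mono rfl (by intro x; simp; omega)
    · refine ((h.cycles.add (ofFour (a := 3 * b + 3) (b := 3 * b + 4) (c := 3 * b + 5)
        (d := 3 * b + 2) near_one near_one near_three near_one).cycles).add
        (ofFour (a := 3 * b + 6) (b := 3 * b + 1) (c := 3 * b) (d := 3 * b - 1) near_five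
          near_one near_one near_seven).cycles).mono rfl (by intro x; simp; omega)
  · have h : CoprimeCycle 4 (Set.Icc (3 * b - 1) (3 * b + 2)) :=
      (upToLeft b 0).mono rfl (by intro x; simp)
    by_cases h5 : (3 * b + 3) % 5 = 0
    · refine ((h.cycles.add (ofFour (a := 3 * b + 5) (b := 3 * b + 6) (c := 3 * b + 7)
        (d := 3 * b + 8) near_one near_one near_one near_three).cycles).add
        (ofFour (a := 3 * b + 3) (b := 3 * b + 4) (c := 3 * b + 9) (d := 3 * b + 10) near_one
          near_five near_one near_seven).cycles).mono rfl (by intro x; simp; omega)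
    · refine ((h.cycles.add (ofFour (a := 3 * b + 6) (b := 3 * b + 5) (c := 3 * b + 4)
        (d := 3 * b + 7) near_one near_one near_three near_one).cycles).add
        (ofFour (a := 3 * b + 3) (b := 3 * b + 8) (c := 3 * b + 9) (d := 3 * b + 10) near_five
          near_one near_one near_seven).cycles).mono rfl (by intro x; simp; omega)

/-- Among three cycles of lengths `4` modulo `6` that are not all `4`-cycles, a longer one may be
put in the middle. -/
theorem three_four (b : ℤ) (x y z : ℕ) :
    CoprimeCycles ({6 * x + 4} + {6 * y + 4} + {6 * z + 4})
      (Set.Icc (3 * b - 1) (3 * b + 6 * x + 6 * y + 6 * z + 10)) := by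
  rcases Nat.eq_zero_or_pos y with rfl | hy
  · rcases Nat.eq_zero_or_pos x with rfl | hx
    · rcases Nat.eq_zero_or_pos z with rfl | hz
      · simpa using three_squares b
      · exact (four_four_four b 0 0 hz).mono (add_right_comm _ _ _) (by intro w; simp)
    · exact (four_four_four b 0 z hx).mono (by rw [add_comm {6 * 0 + 4}])
        (by intro w; simp)
  · exact four_four_four b x z hy

/-- Even cycles whose total length is divisible by `6` fit on a block of full segments: a cycle of
length `0` modulo `6` alone, a cycle of length `4` together with one of length `2` modulo `6`, and
when only lengths `4`, or only lengths `2` modulo `6` are left, three cycles together. -/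
theorem of_sum_dvd (s : Multiset ℕ) (hs : ∀ n ∈ s, Even n ∧ 4 ≤ n) (h6 : s.sum % 6 = 0)
    (b : ℤ) : CoprimeCycles s (Set.Icc (3 * b - 1) (3 * b - 2 + s.sum)) := by
  induction hk : s.card using Nat.strong_induction_on generalizing s b with
  | _ k ih =>
  subst hk
  -- It suffices to split off a family `t` that fits on the first `6 q` labels.
  have step : ∀ (t s' : Multiset ℕ) (q : ℕ), t + s' = s → t ≠ 0 → t.sum = 6 * q →
      CoprimeCycles t (Set.Icc (3 * b - 1) (3 * b - 2 + t.sum)) →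
      CoprimeCycles s (Set.Icc (3 * b - 1) (3 * b - 2 + s.sum)) := by
    rintro t s' q rfl ht hq h
    rw [Multiset.sum_add] at h6 ⊢
    have := ih s'.card (by
      rw [Multiset.card_add]
      have := Multiset.card_pos.2 ht
      omega) s' (fun n hn => hs n (Multiset.mem_add.2 (Or.inr hn))) (by omega) (b + 2 * q) rfl
    refine (h.add this).mono rfl ?_
    intro x
    simp only [Set.mem_union, Set.mem_Icc]
    omega
  rcases eq_or_ne s 0 with rfl | hs0
  · exact ⟨0, rfl, by simp, by simp⟩
  by_cases h0 : ∃ n ∈ s, n % 6 = 0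
  · obtain ⟨n, hn, hn6⟩ := h0
    obtain ⟨q, rfl⟩ : ∃ q, n = 6 * q := ⟨n / 6, by omega⟩
    obtain ⟨s', rfl⟩ := Multiset.exists_cons_of_mem hn
    have := hs _ hn
    refine step {6 * q} s' q rfl (by simp) (by simp) ?_
    exact (full b (q := q) (by omega)).cycles.mono rfl (by intro x; simp)
  push Not at h0
  have even6 : ∀ n ∈ s, (∃ a, n = 6 * a + 4) ∨ ∃ q, 1 ≤ q ∧ n = 6 * q + 2 := fun n hn => by
    have h1 := h0 n hn
    obtain ⟨⟨m, hm⟩, h4⟩ := hs n hn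
    by_cases h : n % 6 = 4
    · exact Or.inl ⟨n / 6, by omega⟩
    · exact Or.inr ⟨n / 6, by omega, by omega⟩
  obtain ⟨x, hx⟩ := Multiset.exists_mem_of_ne_zero hs0
  by_cases h42 : (∃ n ∈ s, n % 6 = 4) ∧ ∃ n ∈ s, n % 6 = 2
  · obtain ⟨⟨x, hx, hx4⟩, y, hy, hy2⟩ := h42
    obtain ⟨s', rfl⟩ := Multiset.exists_cons_of_mem hx
    obtain ⟨a, rfl⟩ := (even6 x hx).resolve_right (by rintro ⟨q, -, rfl⟩; omega)
    obtain ⟨q, hq, rfl⟩ := (even6 y hy).resolve_left (by rintro ⟨q, rfl⟩; omega)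
    obtain ⟨s'', rfl⟩ := Multiset.exists_cons_of_mem
      ((Multiset.mem_cons.1 hy).resolve_left (by omega))
    refine step ({6 * a + 4} + {6 * q + 2}) s'' (a + q + 1) (by simp)
      (by simp) (by simp; ring) ?_
    exact (four_two b a hq).mono rfl (by intro w; simp; omega)
  -- All lengths have the same residue, so there are at least three cycles.
  have same : ∀ n ∈ s, n % 6 = x % 6 := fun n hn => by
    have h1 := even6 n hn
    have h2 := even6 x hx
    by_contra hne
    rcases h1 with ⟨a, ha⟩ | ⟨q, -, hq⟩ <;> rcases h2 with ⟨a', ha'⟩ | ⟨q', -, hq'⟩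
    · omega
    · exact h42 ⟨⟨n, hn, by omega⟩, x, hx, by omega⟩
    · exact h42 ⟨⟨x, hx, by omega⟩, n, hn, by omega⟩
    · omega
  have hx0 := h0 x hx
  have hx2 : x % 2 = 0 := Nat.even_iff.1 (hs x hx).1
  obtain ⟨s₁, rfl⟩ := Multiset.exists_cons_of_mem hx
  have hs₁ : s₁ ≠ 0 := by rintro rfl; simp at h6; omega
  obtain ⟨y, hy⟩ := Multiset.exists_mem_of_ne_zero hs₁
  obtain ⟨s₂, rfl⟩ := Multiset.exists_cons_of_mem hy
  have hyx := same y (by simp)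
  have hs₂ : s₂ ≠ 0 := by rintro rfl; simp at h6; omega
  obtain ⟨z, hz⟩ := Multiset.exists_mem_of_ne_zero hs₂
  obtain ⟨s₃, rfl⟩ := Multiset.exists_cons_of_mem hz
  have hzx := same z (by simp)
  have hxe := even6 x (by simp)
  have hye := even6 y (by simp)
  have hze := even6 z (by simp)
  rcases hxe with ⟨x, rfl⟩ | ⟨x, hx', rfl⟩
  · obtain ⟨y, rfl⟩ := hye.resolve_right (by rintro ⟨q, -, rfl⟩; omega)
    obtain ⟨z, rfl⟩ := hze.resolve_right (by rintro ⟨q, -, rfl⟩; omega)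
    refine step ({6 * x + 4} + {6 * y + 4} + {6 * z + 4}) s₃ (x + y + z + 2)
      (by simp) (by simp) (by simp; ring) ?_
    exact (three_four b x y z).mono rfl (by intro w; simp; omega)
  · obtain ⟨y, hy', rfl⟩ := hye.resolve_left (by rintro ⟨q, rfl⟩; omega)
    obtain ⟨z, hz', rfl⟩ := hze.resolve_left (by rintro ⟨q, rfl⟩; omega)
    refine step ({6 * x + 2} + {6 * y + 2} + {6 * z + 2}) s₃ (x + y + z + 1)
      (by simp) (by simp) (by simp; ring) ?_
    exact (two_two_two b hx' hy' hz').mono rfl (by intro w; simp; omega)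

end CoprimeCycles

/-! ### Even cycles labelled from `1` on -/

namespace CoprimeCycles

open CoprimePath CoprimeCycle

/-- As `1` is coprime to everything, it may be used in place of any other label. -/
theorem replace_by_one {s : Multiset ℕ} {C C' : Set ℤ} (h : CoprimeCycles s C) (a : ℤ)
    (hC : ∀ x ∈ C', (x ∈ C ∧ x ≠ a) ∨ (x = 1 ∧ a ∈ C)) : CoprimeCycles s C' := by
  obtain ⟨F, hF, hc, h⟩ := h
  set f : ℤ → ℤ := fun x => if x = a then 1 else x with hf
  refine ⟨F.map (List.map f), by simp [← hF], fun l hl => ?_, fun x hx => ?_⟩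
  · obtain ⟨l', hl', rfl⟩ := Multiset.mem_map.1 hl
    refine (hc l' hl').map fun x y hxy => ?_
    simp only [hf]
    split_ifs <;> simp [hxy]
  · rcases hC x hx with ⟨hx, hxa⟩ | ⟨rfl, ha⟩
    · obtain ⟨l, hl, hxl⟩ := h x hx
      exact ⟨_, Multiset.mem_map_of_mem _ hl, List.mem_map.2 ⟨x, hxl, by simp [hf, hxa]⟩⟩
    · obtain ⟨l, hl, hxl⟩ := h a ha
      exact ⟨_, Multiset.mem_map_of_mem _ hl, List.mem_map.2 ⟨a, hxl, by simp [hf]⟩⟩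

theorem run_from_one (n : ℕ) (hn : 1 ≤ n) : CoprimeCycle n (Set.Icc 1 n) := by
  obtain ⟨m, rfl⟩ : ∃ m, n = m + 1 := ⟨n - 1, by omega⟩
  exact (run 1 m).close (by simp) rfl (by intro x; simp; omega)

theorem exists_residue {s : Multiset ℕ} (h : s.sum % 6 ≠ 0) : ∃ n ∈ s, n % 6 ≠ 0 := by
  by_contra! hs
  exact h (Nat.mod_eq_zero_of_dvd (Multiset.dvd_sum fun n hn => Nat.dvd_of_mod_eq_zero (hs n hn)))

/-- Any family of even cycles can be labelled with the integers from `1` on. The label `1`, being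
coprime to everything, and the labels `2, 3, 4` take care of the total length modulo `6`. -/
theorem of_even (s : Multiset ℕ) (hs : ∀ n ∈ s, Even n ∧ 4 ≤ n) :
    CoprimeCycles s (Set.Icc 1 s.sum) := by
  have hs2 : ∀ n ∈ s, n % 2 = 0 := fun n hn => Nat.even_iff.1 (hs n hn).1
  have hsum2 : s.sum % 2 = 0 :=
    Nat.mod_eq_zero_of_dvd (Multiset.dvd_sum fun n hn => Nat.dvd_of_mod_eq_zero (hs2 n hn))
  rcases (by omega : s.sum % 6 = 0 ∨ s.sum % 6 = 4 ∨ s.sum % 6 = 2) with h6 | h6 | h6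
  · refine (of_sum_dvd s hs h6 1).replace_by_one (s.sum + 1) fun x hx => ?_
    simp only [Set.mem_Icc] at *
    omega
  · by_cases h4 : ∃ n ∈ s, n % 6 = 4
    · obtain ⟨n, hn, hn4⟩ := h4
      obtain ⟨a, rfl⟩ : ∃ a, n = 6 * a + 4 := ⟨n / 6, by omega⟩
      obtain ⟨s, rfl⟩ := Multiset.exists_cons_of_mem hn
      rw [Multiset.sum_cons] at h6
      refine ((run_from_one (6 * a + 4) (by omega)).cycles.add (of_sum_dvd s
        (fun n hn => hs n (Multiset.mem_cons_of_mem hn)) (by omega) (2 * a + 2))).mono rfl ?_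
      intro x
      simp
      omega
    · -- The cycles `1, 2, 5, 6, …, x + 2` and `3, 4, x + 3, …, x + y`.
      push Not at h4
      obtain ⟨x, hx, hx6⟩ := exists_residue (s := s) (by omega)
      have := hs2 x hx
      have := hs x hx
      have := h4 x hx
      obtain ⟨s, rfl⟩ := Multiset.exists_cons_of_mem hx
      rw [Multiset.sum_cons] at h6
      obtain ⟨y, hy, hy6⟩ := exists_residue (s := s) (by omega)
      have := hs2 y (Multiset.mem_cons_of_mem hy)
      have := hs y (Multiset.mem_cons_of_mem hy)
      have := h4 y (Multiset.mem_cons_of_mem hy)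
      obtain ⟨s, rfl⟩ := Multiset.exists_cons_of_mem hy
      rw [Multiset.sum_cons] at h6
      obtain ⟨a, rfl⟩ : ∃ a, x = 6 * (a + 1) + 2 := ⟨x / 6 - 1, by omega⟩
      obtain ⟨c, rfl⟩ : ∃ c, y = 6 * (c + 1) + 2 := ⟨y / 6 - 1, by omega⟩
      have h1 : CoprimeCycle (6 * (a + 1) + 2) (Set.Icc 1 2 ∪ Set.Icc 5 (6 * a + 10)) :=
        ((run' (a := 1) (b := 2) (n := 1) rfl).join (run' (a := 5) (b := 6 * a + 10)
          (n := 6 * a + 5) (by push_cast; ring)) (near_three (Or.inr rfl))).close (by simp)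
          (by omega) fun _ h => h
      have h2 : CoprimeCycle (6 * (c + 1) + 2)
          (Set.Icc 3 4 ∪ Set.Icc (6 * a + 11) (6 * a + 6 * c + 16)) := by
        refine ((run' (a := 3) (b := 4) (n := 1) rfl).join (run' (a := 6 * a + 11)
          (b := 6 * a + 6 * c + 16) (n := 6 * c + 5) (by push_cast; ring)) ?_).close ?_
          (by omega) fun _ h => h
        · have : IsCoprime (2 ^ 2 : ℤ) (6 * a + 11) :=
            (IsCoprime.pow_left ⟨-(3 * a + 5), 1, by ring⟩)
          exact Int.isCoprime_iff_gcd_eq_one.1 this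
        · exact Int.isCoprime_iff_gcd_eq_one.1 ⟨1, -(2 * a + 2 * c + 5), by ring⟩
      refine ((h1.cycles.add h2.cycles).add (of_sum_dvd s
        (fun n hn => hs n (Multiset.mem_cons_of_mem (Multiset.mem_cons_of_mem hn))) (by omega)
        (2 * a + 2 * c + 6))).mono (by simp) ?_
      intro x
      simp
      omega
  · by_cases h2 : ∃ n ∈ s, n % 6 = 2
    · -- The last cycle consists of consecutive labels and of the label `1`.
      obtain ⟨n, hn, hn2⟩ := h2
      have := hs n hn
      obtain ⟨q, rfl⟩ : ∃ q, n = q + 2 := ⟨n - 2, by omega⟩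
      obtain ⟨s, rfl⟩ := Multiset.exists_cons_of_mem hn
      rw [Multiset.sum_cons] at h6
      have h1 : CoprimeCycle (q + 2) ({1} ∪ Set.Icc (s.sum + 2 : ℤ) (s.sum + 2 + q)) :=
        ((single 1).join (run _ q) (by simp)).close (by simp) (by omega) fun _ h => h
      refine (h1.cycles.add (of_sum_dvd s (fun n hn => hs n (Multiset.mem_cons_of_mem hn))
        (by omega) 1)).mono rfl ?_
      intro x
      simp
      omega
    · push Not at h2
      obtain ⟨x, hx, hx6⟩ := exists_residue (s := s) (by omega)
      have := hs2 x hx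
      have := h2 x hx
      obtain ⟨s, rfl⟩ := Multiset.exists_cons_of_mem hx
      rw [Multiset.sum_cons] at h6
      obtain ⟨y, hy, hy6⟩ := exists_residue (s := s) (by omega)
      have := hs2 y (Multiset.mem_cons_of_mem hy)
      have := h2 y (Multiset.mem_cons_of_mem hy)
      obtain ⟨s, rfl⟩ := Multiset.exists_cons_of_mem hy
      rw [Multiset.sum_cons] at h6
      obtain ⟨a, rfl⟩ : ∃ a, x = 6 * a + 4 := ⟨x / 6, by omega⟩
      obtain ⟨c, rfl⟩ : ∃ c, y = 6 * c + 4 := ⟨y / 6, by omega⟩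
      obtain ⟨r, hr⟩ : ∃ r, s.sum = 6 * r := ⟨s.sum / 6, by omega⟩
      refine (((run_from_one (6 * a + 4) (by omega)).cycles.add
        (upToLeft (2 * a + 2 + 2 * r) c).cycles).add (of_sum_dvd s
        (fun n hn => hs n (Multiset.mem_cons_of_mem (Multiset.mem_cons_of_mem hn))) (by omega)
        (2 * a + 2))).mono (by simp) ?_
      intro x
      simp [hr]
      omega

end CoprimeCycles

/-! ### Odd cycles -/

/-- An integer that is `5` modulo `6` has a prime factor that is `5` modulo `6`. -/
theorem exists_prime_dvd_mod_six (n : ℕ) (hn : n % 6 = 5) :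
    ∃ p : ℕ, p.Prime ∧ p % 6 = 5 ∧ p ∣ n := by
  induction n using Nat.strong_induction_on with
  | _ n ih =>
  have hp : n.minFac.Prime := Nat.minFac_prime (by omega)
  obtain ⟨m, hm⟩ := n.minFac_dvd
  by_cases h5 : n.minFac % 6 = 5
  · exact ⟨_, hp, h5, n.minFac_dvd⟩
  · have hmod : (n.minFac % 6) * (m % 6) % 6 = 5 := by rw [← Nat.mul_mod, ← hm, hn]
    have key : ∀ a < 6, ∀ b < 6, a ≠ 5 → a * b % 6 = 5 → b = 5 := by decide
    have hm5 : m % 6 = 5 :=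
      key _ (Nat.mod_lt _ (by norm_num)) _ (Nat.mod_lt _ (by norm_num)) h5 hmod
    have hlt : m < n := by
      rw [hm]
      exact lt_mul_of_one_lt_left (by omega) hp.one_lt
    obtain ⟨p, hp, hp5, hpm⟩ := ih m hlt hm5
    exact ⟨p, hp, hp5, hpm.trans ⟨_, by rw [mul_comm]; exact hm⟩⟩

namespace CoprimeCycle

open CoprimePath

/-- Two odd neighbours are needed on an odd cycle. Here and below their distance is a power
of `2`. -/
theorem odd_full (b : ℤ) (q : ℕ) (hb : (3 * b - 1) % 2 = 1) :
    CoprimeCycle (6 * q + 3) (Set.Icc (3 * b - 1) (3 * b + 6 * q + 1)) := by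
  rcases q with _ | m
  · exact (seg b).close near_two rfl (by intro x; simp)
  · exact (((twoSeg b).ladder m).join (seg (b + 2 * m + 2)) near_one).close near_eight (by omega)
      (by intro x; simp; omega)

theorem odd_upToMiddle (b : ℤ) (q : ℕ) (hb : (3 * b - 1) % 2 = 1) :
    CoprimeCycle (6 * q + 5) (Set.Icc (3 * b - 1) (3 * b + 6 * q + 3)) := by
  rcases q with _ | m
  · exact (run' (a := 3 * b - 1) (b := 3 * b + 3) (n := 4) (by push_cast; ring)).close near_four
      rfl (by intro x; simp)
  · exact ((((twoSeg b).ladder m).join (seg (b + 2 * m + 2)) near_one).join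
      (pair (3 * (b + 2 * m + 3) - 1)) near_two).close near_nine (by omega)
      (by intro x; simp; omega)

theorem odd_fromMiddle (j : ℤ) (q : ℕ) (hj : 3 * j % 2 = 1) :
    CoprimeCycle (6 * q + 5) (Set.Icc (3 * j) (3 * j + 6 * q + 4)) :=
  (odd_upToMiddle (-j - 2 * q - 1) q (by omega)).neg (by intro x; simp; omega)

/-- A beginning, fit for `CoprimePath.ladder`, that covers the right end of the segment `p` and the
next two segments. -/
theorem _root_.CoprimePath.oddRight (p : ℤ) (hp : (3 * p + 1) % 2 = 1) :
    CoprimePath (3 * (p + 2) - 4) (3 * (p + 2) + 1) 7 (Set.Icc (3 * p + 1) (3 * p + 7)) :=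
  (((seg (p + 1)).join (single (3 * p + 1)) near_three).join (seg (p + 2)) near_four).congr
    (by omega) rfl rfl (by intro x; simp; omega)

theorem odd_fromRight (p : ℤ) {q : ℕ} (hq : 1 ≤ q) (hp : (3 * p + 1) % 2 = 1) :
    CoprimeCycle (6 * q + 1) (Set.Icc (3 * p + 1) (3 * p + 6 * q + 1)) := by
  obtain rfl | ⟨m, rfl⟩ : q = 1 ∨ ∃ m, q = m + 2 := by
    rcases q with _ | _ | m
    · omega
    · exact Or.inl rfl
    · exact Or.inr ⟨m, rfl⟩
  · exact (((single (3 * p + 1)).join (seg (p + 1)) near_one).join (seg (p + 2)).symm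
      near_three).close near_four rfl (by intro x; simp; omega)
  · exact ((((oddRight p hp).ladder m).join (seg (p + 2 * m + 3)) near_one).join
      (seg (p + 2 * m + 4)).symm near_three).close near_nine (by omega) (by intro x; simp; omega)

theorem odd_upToLeft (b : ℤ) {q : ℕ} (hq : 1 ≤ q) (hb : (3 * b - 1) % 2 = 1) :
    CoprimeCycle (6 * q + 1) (Set.Icc (3 * b - 1) (3 * b + 6 * q - 1)) :=
  (odd_fromRight (-b - 2 * q) hq (by omega)).neg (by intro x; simp; omega)

theorem odd_rightToLeft (p : ℤ) (q : ℕ) (hp : (3 * p + 1) % 2 = 1) :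
    CoprimeCycle (6 * q + 5) (Set.Icc (3 * p + 1) (3 * p + 6 * q + 5)) := by
  rcases q with _ | m
  · exact (run' (a := 3 * p + 1) (b := 3 * p + 5) (n := 4) (by push_cast; ring)).close near_four
      rfl (by intro x; simp)
  · exact ((((oddRight p hp).ladder m).join (seg (p + 2 * m + 3)) near_one).join
      (single (3 * (p + 2 * m + 4) - 1)) near_one).close near_nine (by omega)
      (by intro x; simp; omega)

theorem odd_middleToLeft (j : ℤ) (q : ℕ) (hj : 3 * j % 2 = 1) :
    CoprimeCycle (6 * q + 3) (Set.Icc (3 * j) (3 * j + 6 * q + 2)) := by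
  obtain rfl | rfl | ⟨m, hm, rfl⟩ : q = 0 ∨ q = 1 ∨ ∃ m, 1 ≤ m ∧ q = m + 1 := by
    rcases q with _ | _ | m
    · exact Or.inl rfl
    · exact Or.inr (Or.inl rfl)
    · exact Or.inr (Or.inr ⟨m + 1, by omega, rfl⟩)
  · exact (run' (a := 3 * j) (b := 3 * j + 2) (n := 2) (by push_cast; ring)).close near_two
      rfl (by intro x; simp)
  · exact (run' (a := 3 * j) (b := 3 * j + 8) (n := 8) (by push_cast; ring)).close near_eight
      rfl (by intro x; simp; omega)
  · obtain ⟨v, hv, h⟩ := (((pair (3 * j)).join (seg (j + 1)) near_two).congr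
      (u' := 3 * (j + 1) - 2) (by omega) rfl rfl fun _ h => h).exists_of_right_ends hm
    have hv' : Int.gcd v (3 * (j + 2 * m + 2) - 1) = 1 := by
      rcases hv with rfl | rfl
      · exact near_three
      · exact near_one
    exact ((h.join (seg (j + 2 * m + 2)) hv').join (single (3 * (j + 2 * m + 3) - 1))
      near_one).close near_nine (by omega) (by intro x; simp; omega)

theorem odd_rightToMiddle (p : ℤ) (q : ℕ) (hp : (3 * p + 1) % 2 = 1) :
    CoprimeCycle (6 * q + 3) (Set.Icc (3 * p + 1) (3 * p + 6 * q + 3)) :=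
  (odd_middleToLeft (-p - 2 * q - 1) q (by omega)).neg (by intro x; simp; omega)

/-- The lower part of the cycle runs from the label `3 j + p - 1` down to `3 j`, goes on with
`3 j + p`, which is coprime to `3 j` since `p` does not divide `3 j`, and ends with `3 j + p + 2`.
If `p = 6 u - 1` and `x = j + 2 u`, then its ends are the right ends of the segments `x - 1`
and `x`. -/
theorem odd_middleToMiddle_of_not_dvd (j : ℤ) (s : ℕ) (hj : 3 * j % 2 = 1)
    {p : ℕ} (hp : p.Prime) (hp6 : p % 6 = 5) (hps : p < 6 * s) (hpj : ¬(p : ℤ) ∣ 3 * j) :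
    CoprimeCycle (6 * s + 1) (Set.Icc (3 * j) (3 * j + 6 * s)) := by
  obtain ⟨u, hu⟩ : ∃ u, p = 6 * u + 5 := ⟨p / 6, by omega⟩
  have hgcd : Int.gcd (3 * j) (3 * (j + 2 * u + 2) - 1) = 1 :=
    gcd_eq_one_of_dist_prime_pow hp 1 (Or.inr (by push_cast [hu]; ring))
      fun h => hpj (Int.dvd_of_emod_eq_zero h)
  have low : CoprimePath (3 * (j + 2 * u + 2) - 2) (3 * j) (6 * u + 5)
      (Set.Icc (3 * j) (3 * (j + 2 * u + 2) - 2)) :=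
    (run' (n := 6 * u + 4) (by push_cast; ring)).symm
  obtain h | ⟨m, hm⟩ : s = u + 1 ∨ ∃ m, s = u + m + 2 := by
    by_cases h : s = u + 1
    · exact Or.inl h
    · exact Or.inr ⟨s - u - 2, by omega⟩
  · subst h
    exact (low.join (pair (3 * (j + 2 * u + 2) - 1)).symm hgcd).close near_two (by omega)
      (by intro x; simp; omega)
  subst hm
  have low' := low.join (seg (j + 2 * u + 2)) hgcd
  rcases Nat.eq_zero_or_pos m with rfl | hm
  · exact ((low'.join (seg (j + 2 * u + 3)) near_one).join
      (pair (3 * (j + 2 * u + 4) - 1)).symm near_one).close near_eight (by omega)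
      (by intro x; simp; omega)
  · obtain ⟨v, hv, h⟩ := low'.exists_of_right_ends hm
    have hv' : Int.gcd v (3 * (j + 2 * u + 2 * m + 3) - 1) = 1 := by
      rcases hv with rfl | rfl
      · exact near_three
      · exact near_one
    exact ((h.join (seg (j + 2 * u + 2 * m + 3)) hv').join
      (pair (3 * (j + 2 * u + 2 * m + 4) - 1)) near_two).close near_nine (by omega)
      (by intro x; simp; omega)

/-- When both ends of the label interval are divisible by `3`, one of them has to be joined to a
label at odd distance greater than `1`. A prime factor `p` of `6 s - 1` serves as the distance: it
does not divide the difference `6 s` of the two ends, hence not both of them. -/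
theorem odd_middleToMiddle (j : ℤ) {s : ℕ} (hs : 1 ≤ s) (hj : 3 * j % 2 = 1) :
    CoprimeCycle (6 * s + 1) (Set.Icc (3 * j) (3 * j + 6 * s)) := by
  obtain ⟨p, hp, hp6, hps⟩ := exists_prime_dvd_mod_six (6 * s - 1) (by omega)
  have hlt : p < 6 * s := by
    have := Nat.le_of_dvd (by omega) hps
    omega
  by_cases hpj : (p : ℤ) ∣ 3 * j
  · refine (odd_middleToMiddle_of_not_dvd (-j - 2 * s) s (by omega) hp hp6 hlt
      fun h => ?_).neg (by intro x; simp; omega)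
    have h1 : (p : ℤ) ∣ 6 * s - 1 := by
      have := Int.natCast_dvd_natCast.2 hps
      rwa [Nat.cast_sub (by omega), Nat.cast_mul] at this
    have h2 : (p : ℤ) ∣ 1 := by
      have := dvd_add (dvd_add h hpj) h1
      rwa [show 3 * (-j - 2 * s) + 3 * j + (6 * s - 1) = (-1 : ℤ) by ring, dvd_neg] at this
    exact hp.one_lt.ne' (by exact_mod_cast Int.eq_one_of_dvd_one (by positivity) h2)
  · exact odd_middleToMiddle_of_not_dvd j s hj hp hp6 hlt hpj

/-- An odd number of consecutive integers, the first of them odd, form a coprime cycle. -/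
theorem of_odd (k : ℤ) (n : ℕ) (hn3 : 3 ≤ n) (hn : Odd n) (hk : Odd k) :
    CoprimeCycle n (Set.Icc k (k + n - 1)) := by
  have hn2 := Nat.odd_iff.1 hn
  have hk2 := Int.odd_iff.1 hk
  obtain ⟨q, hq⟩ : ∃ q, n = 6 * q + 1 ∨ n = 6 * q + 3 ∨ n = 6 * q + 5 := ⟨n / 6, by omega⟩
  obtain ⟨j, hj⟩ : ∃ j, k = 3 * j ∨ k = 3 * j + 1 ∨ k = 3 * j - 1 := ⟨(k + 1) / 3, by omega⟩
  rcases hq with rfl | rfl | rfl <;> rcases hj with rfl | rfl | rfl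
  · exact (odd_middleToMiddle j (by omega) hk2).mono rfl (by intro x; simp; omega)
  · exact (odd_fromRight j (by omega) hk2).mono rfl (by intro x; simp; omega)
  · exact (odd_upToLeft j (by omega) hk2).mono rfl (by intro x; simp)
  · exact (odd_middleToLeft j q hk2).mono rfl (by intro x; simp; omega)
  · exact (odd_rightToMiddle j q hk2).mono rfl (by intro x; simp; omega)
  · exact (odd_full j q hk2).mono rfl (by intro x; simp; omega)
  · exact (odd_fromMiddle j q hk2).mono rfl (by intro x; simp; omega)
  · exact (odd_rightToLeft j q hk2).mono rfl (by intro x; simp; omega)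
  · exact (odd_upToMiddle j q hk2).mono rfl (by intro x; simp; omega)

end CoprimeCycle

/-! ### From coprime cycles to prime labelings -/

/-- A map from a set of `N` elements that attains all of `N` consecutive integers is a bijection
onto them. -/
theorem bijOn_Icc_of_forall_exists {V : Type*} [Fintype V] (k : ℤ) (f : V → ℤ)
    (h : ∀ x ∈ Set.Icc k (k + (Fintype.card V : ℤ) - 1), ∃ v, f v = x) :
    Set.BijOn f Set.univ (Set.Icc k (k + (Fintype.card V : ℤ) - 1)) := by
  classical
  have hsub : Finset.Icc k (k + (Fintype.card V : ℤ) - 1) ⊆ Finset.univ.image f := fun x hx => by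
    obtain ⟨v, hv⟩ := h x (by simpa using hx)
    exact Finset.mem_image.2 ⟨v, Finset.mem_univ v, hv⟩
  have hcard : (Finset.Icc k (k + (Fintype.card V : ℤ) - 1)).card = Fintype.card V := by
    rw [Int.card_Icc]; omega
  have himg : (Finset.univ.image f).card ≤ Fintype.card V := Finset.card_image_le
  have heq := Finset.eq_of_subset_of_card_le hsub (himg.trans hcard.ge)
  have hinj : Set.InjOn f (Finset.univ : Finset V) := by
    rw [← Finset.card_image_iff, ← heq, hcard, Finset.card_univ]
  refine ⟨fun v _ => ?_, by simpa using hinj, fun x hx => ?_⟩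
  · have : f v ∈ Finset.univ.image f := Finset.mem_image_of_mem f (Finset.mem_univ v)
    rw [← heq] at this
    simpa using this
  · obtain ⟨v, hv⟩ := h x hx
    exact ⟨v, trivial, hv⟩

theorem IsCoprimeCycle.gcd_eq_one_of_adj {l : List ℤ} (hl : IsCoprimeCycle l) {n : ℕ}
    (hn : l.length = n) {u v : Fin n} (h : (SimpleGraph.cycleGraph n).Adj u v) :
    Int.gcd l[u] l[v] = 1 := by
  subst hn
  have key : ∀ u v : Fin l.length, (v - u).val = 1 → Int.gcd l[u] l[v] = 1 := by
    intro u v huv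
    rw [Fin.sub_def] at huv
    simp only at huv
    have hu := u.isLt
    have hv := v.isLt
    rcases le_or_gt u.val v.val with hle | hlt
    · have hvu : v.val = u.val + 1 := by
        rw [show l.length - u.val + v.val = (v.val - u.val) + l.length by omega,
          Nat.add_mod_right, Nat.mod_eq_of_lt (by omega)] at huv
        omega
      have := hl.1.getElem u.val (by omega)
      simpa [hvu] using this
    · rw [Nat.mod_eq_of_lt (by omega)] at huv
      have hu1 : u.val = l.length - 1 := by omega
      have hv0 : v.val = 0 := by omega
      refine hl.2 _ ?_ _ ?_
      · rw [List.getLast?_eq_getElem?]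
        simp [← hu1]
      · rw [List.head?_eq_getElem?]
        simp [← hv0]
  rcases SimpleGraph.cycleGraph_adj'.1 h with h | h
  · rw [Int.gcd_comm]
    exact key v u h
  · exact key u v h

theorem CoprimeCycle.exists_isPrimeLabelingFrom {n : ℕ} {k : ℤ}
    (h : CoprimeCycle n (Set.Icc k (k + n - 1))) :
    ∃ f : Fin n → ℤ, IsPrimeLabelingFrom (SimpleGraph.cycleGraph n) k f := by
  obtain ⟨l, hl, rfl, hC⟩ := h
  refine ⟨fun i => l[i], bijOn_Icc_of_forall_exists k _ fun x hx => ?_,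
    fun u v huv => hl.gcd_eq_one_of_adj rfl huv⟩
  rw [Fintype.card_fin] at hx
  obtain ⟨i, hi, hix⟩ := List.getElem_of_mem (hC x hx)
  exact ⟨⟨i, hi⟩, hix⟩

theorem exists_list_of_map_eq {α β : Type*} (f : α → β) (F : Multiset α) (l : List β)
    (h : F.map f = l) : ∃ L : List α, (L : Multiset α) = F ∧ L.map f = l := by
  induction l generalizing F with
  | nil => exact ⟨[], (Multiset.map_eq_zero.1 h).symm, rfl⟩
  | cons b l ih =>
    classical
    obtain ⟨a, ha, rfl, hF⟩ := (Multiset.map_eq_cons (f := f) F l b).2 h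
    obtain ⟨L, hL, rfl⟩ := ih _ hF
    exact ⟨a :: L, by rw [← Multiset.cons_coe, hL, Multiset.cons_erase ha], rfl⟩

theorem CoprimeCycles.isPrimeGraph {m : ℕ} {n : Fin m → ℕ}
    (h : CoprimeCycles (Finset.univ.val.map n) (Set.Icc 1 (∑ i, n i : ℕ))) :
    IsPrimeGraph (disjointUnion fun i => SimpleGraph.cycleGraph (n i)) := by
  obtain ⟨F, hF, hc, hC⟩ := h
  rw [Fin.univ_val_map] at hF
  obtain ⟨L, rfl, hL⟩ := exists_list_of_map_eq _ _ _ hF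
  have hm : L.length = m := by simpa using congrArg List.length hL
  subst hm
  have hlen : ∀ i : Fin L.length, (L[i]).length = n i := fun i => by
    have := congrArg (fun l => l[i.val]?) hL
    simpa using this
  refine ⟨fun v => (L[v.1])[v.2.val]'(by rw [hlen]; exact v.2.isLt),
    bijOn_Icc_of_forall_exists 1 _ fun x hx => ?_, ?_⟩
  · rw [Fintype.card_sigma] at hx
    simp only [Fintype.card_fin] at hx
    obtain ⟨l, hl, hxl⟩ := hC x (by simpa using hx)
    obtain ⟨i, hi, rfl⟩ := List.getElem_of_mem (Multiset.mem_coe.1 hl)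
    obtain ⟨j, hj, hjx⟩ := List.getElem_of_mem hxl
    exact ⟨⟨⟨i, hi⟩, ⟨j, by rw [← hlen]; exact hj⟩⟩, hjx⟩
  · rintro _ _ ⟨i, a, b, hab, rfl, rfl⟩
    exact (hc _ (Multiset.mem_coe.2 (List.getElem_mem i.isLt))).gcd_eq_one_of_adj (hlen i) hab

theorem IsPrimeGraph.of_iso {V W : Type*} [Fintype V] [Fintype W] {G : SimpleGraph V}
    {H : SimpleGraph W} (e : G ≃g H) (h : IsPrimeGraph H) : IsPrimeGraph G := by
  obtain ⟨f, hf, hadj⟩ := h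
  refine ⟨f ∘ e, ?_, fun u v huv => hadj _ _ (e.map_rel_iff.2 huv)⟩
  rw [Fintype.card_congr e.toEquiv]
  exact hf.comp (Set.bijOn_univ.2 e.bijective)

/-! ### At most one odd cycle -/

/-- Even labels count `1`, odd labels count `-1`. -/
def paritySign (x : ℤ) : ℤ := if Even x then 1 else -1

theorem sum_paritySign_Icc (N : ℕ) :
    ∑ x ∈ Finset.Icc (1 : ℤ) N, paritySign x = -((N % 2 : ℕ) : ℤ) := by
  induction N with
  | zero => simp
  | succ N ih =>
    have : Finset.Icc (1 : ℤ) (N + 1 : ℕ) = insert ((N : ℤ) + 1) (Finset.Icc (1 : ℤ) N) := by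
      ext x
      simp only [Finset.mem_insert, Finset.mem_Icc]
      push_cast
      omega
    rw [this, Finset.sum_insert (by simp), ih, paritySign]
    split_ifs with h
    · rw [Int.even_iff] at h; omega
    · rw [Int.even_iff] at h; omega

/-- Two even labels are never adjacent, so a cycle has at least as many odd as even labels. -/
theorem sum_paritySign_cycle_le {n : ℕ} (hn : 3 ≤ n) (g : Fin n → ℤ)
    (h : ∀ u v, (SimpleGraph.cycleGraph n).Adj u v → Int.gcd (g u) (g v) = 1) :
    ∑ v, paritySign (g v) ≤ -((n % 2 : ℕ) : ℤ) := by
  have hdvd : (2 : ℤ) ∣ ∑ v : Fin n, (paritySign (g v) + 1) := Finset.dvd_sum fun v _ => by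
    unfold paritySign
    split_ifs <;> norm_num
  rw [Finset.sum_add_distrib] at hdvd
  simp only [Finset.sum_const, Finset.card_univ, Fintype.card_fin, nsmul_eq_mul, mul_one] at hdvd
  obtain ⟨k, rfl⟩ : ∃ k, n = k + 2 := ⟨n - 2, by omega⟩
  have hle : ∀ v : Fin (k + 2), paritySign (g v) + paritySign (g (v + 1)) ≤ 0 := fun v => by
    have hv := h v (v + 1) (SimpleGraph.cycleGraph_adj.2 (Or.inr (by simp)))
    unfold paritySign
    split_ifs with h1 h2 <;> norm_num
    have := Int.dvd_coe_gcd h1.two_dvd h2.two_dvd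
    rw [hv] at this
    omega
  have hshift : ∑ v : Fin (k + 2), paritySign (g (v + 1)) = ∑ v, paritySign (g v) :=
    Equiv.sum_comp (Equiv.addRight (1 : Fin (k + 2))) fun v => paritySign (g v)
  have := Finset.sum_nonpos fun v (_ : v ∈ Finset.univ) => hle v
  rw [Finset.sum_add_distrib, hshift] at this
  omega

theorem IsPrimeGraph.eq_of_odd {m : ℕ} {n : Fin m → ℕ} (hn : ∀ i, 3 ≤ n i)
    (h : IsPrimeGraph (disjointUnion fun i => SimpleGraph.cycleGraph (n i))) (i j : Fin m)
    (hi : Odd (n i)) (hj : Odd (n j)) : i = j := by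
  obtain ⟨f, hf, hadj⟩ := h
  by_contra hij
  set N := Fintype.card (Σ i, Fin (n i)) with hN
  have htotal : ∑ v, paritySign (f v) = -((N % 2 : ℕ) : ℤ) := by
    rw [← sum_paritySign_Icc]
    refine Finset.sum_bij (fun v _ => f v) (fun v _ => ?_) (fun u _ v _ => ?_) (fun x hx => ?_)
      fun _ _ => rfl
    · have := hf.mapsTo (Set.mem_univ v)
      rw [Set.mem_Icc] at this
      rw [Finset.mem_Icc]
      omega
    · exact fun huv => hf.injOn (Set.mem_univ u) (Set.mem_univ v) huv
    · rw [Finset.mem_Icc] at hx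
      obtain ⟨v, -, hv⟩ := hf.surjOn (show x ∈ Set.Icc 1 (1 + (N : ℤ) - 1) by
        rw [Set.mem_Icc]; omega)
      exact ⟨v, Finset.mem_univ v, hv⟩
  have hcycle : ∀ i, ∑ v : Fin (n i), paritySign (f ⟨i, v⟩) ≤ -((n i % 2 : ℕ) : ℤ) := fun i =>
    sum_paritySign_cycle_le (hn i) _ fun u v huv => hadj _ _ ⟨i, u, v, huv, rfl, rfl⟩
  rw [Fintype.sum_sigma] at htotal
  have hrest := Finset.sum_nonpos fun k (_ : k ∈ Finset.univ \ {i, j}) =>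
    (hcycle k).trans (by omega)
  have hsum := Finset.sum_sdiff (Finset.subset_univ {i, j})
    (f := fun k => ∑ v : Fin (n k), paritySign (f ⟨k, v⟩))
  rw [Finset.sum_pair hij] at hsum
  have h1 := hcycle i
  have h2 := hcycle j
  rw [Nat.odd_iff.1 hi] at h1
  rw [Nat.odd_iff.1 hj] at h2
  omega

/-- The even cycles receive the labels from `1` on, and a remaining odd cycle receives the last
labels, the first of which is odd. -/
theorem isPrimeGraph_of_forall_odd_eq {m : ℕ} {n : Fin m → ℕ} (hn : ∀ i, 3 ≤ n i)
    (h : ∀ i j, Odd (n i) → Odd (n j) → i = j) :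
    IsPrimeGraph (disjointUnion fun i => SimpleGraph.cycleGraph (n i)) := by
  have heven : ∀ i, ¬Odd (n i) → Even (n i) ∧ 4 ≤ n i := fun i hi => by
    rw [Nat.not_odd_iff_even] at hi
    have := hn i
    have := Nat.even_iff.1 hi
    exact ⟨hi, by omega⟩
  apply CoprimeCycles.isPrimeGraph
  by_cases hodd : ∃ i, Odd (n i)
  · obtain ⟨i, hi⟩ := hodd
    set s := (Finset.univ.erase i).val.map n with hs
    have hcons : Finset.univ.val.map n = n i ::ₘ s := by
      rw [hs, ← Multiset.map_cons, Finset.erase_val, Multiset.cons_erase (Finset.mem_univ_val i)]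
    have hsum : ∑ i, n i = n i + s.sum := by
      rw [← Multiset.sum_cons, ← hcons]
      rfl
    have hmem : ∀ k ∈ s, Even k ∧ 4 ≤ k := fun k hk => by
      obtain ⟨j, hj, rfl⟩ := Multiset.mem_map.1 hk
      exact heven j fun hjo => Finset.ne_of_mem_erase (show j ∈ Finset.univ.erase i from hj)
        (h j i hjo hi)
    have hs2 : Even s.sum := even_iff_two_dvd.2
      (Multiset.dvd_sum fun k hk => even_iff_two_dvd.1 (hmem k hk).1)
    have hc := (CoprimeCycle.of_odd (s.sum + 1) (n i) (hn i) hi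
      (by exact_mod_cast hs2.add_one)).cycles.add (CoprimeCycles.of_even s hmem)
    refine hc.mono hcons.symm ?_
    intro x
    rw [hsum]
    simp only [Set.mem_union, Set.mem_Icc]
    push_cast
    omega
  · push Not at hodd
    exact CoprimeCycles.of_even _ fun k hk => by
      obtain ⟨j, -, rfl⟩ := Multiset.mem_map.1 hk
      exact heven j (by simpa using hodd j)

theorem mainTheorem2 :
    (∀ (n : ℕ) (k : ℤ), 3 ≤ n → Odd n → Odd k →
      ∃ f : Fin n → ℤ, IsPrimeLabelingFrom (SimpleGraph.cycleGraph n) k f) ∧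
    (∀ (V : Type*) [Fintype V] (G : SimpleGraph V) (m : ℕ) (n : Fin m → ℕ),
      (∀ i, 3 ≤ n i) →
      Nonempty (G ≃g disjointUnion (fun i => SimpleGraph.cycleGraph (n i))) →
      (IsPrimeGraph G ↔ ∀ i j, Odd (n i) → Odd (n j) → i = j)) := by
  refine ⟨fun n k hn hodd hk => (CoprimeCycle.of_odd k n hn hodd hk).exists_isPrimeLabelingFrom,
    fun V _ G m n hn ⟨e⟩ => ⟨fun h => (h.of_iso e.symm).eq_of_odd hn,
      fun h => (isPrimeGraph_of_forall_odd_eq hn h).of_iso e⟩⟩
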